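/- **Setting.** Let $S$ be a finite set of sorts. Let $\mathcal D$ be a locally finite variety of (finitary, one-sorted) algebras or of ordered algebras in which every epimorphism is surjective, and let $\mathcal C$ be a locally finite variety of algebras whose signature contains a constant; fix such a constant $c$. Let $P:\mathcal D_f^{op}\simeq\mathcal C_f$ be an equivalence between the full subcategories of finite algebras, with inverse $P^{-1}$. Let $\mathbf T=(T,\eta,\mu)$ be a monad on $\mathcal D^S$ preserving epimorphisms, and let $\mathcal F$ be a class of finite $\mathbf T$-algebras closed under quotients (codomains of sortwise surjective homomorphisms), subalgebras (domains of sortwise injective, in the ordered case order-reflecting, homomorphisms) and finite products. Let $\Sigma$ be a finite $S$-sorted alphabet, let $\mathbb\Sigma\in\mathcal D^S$ be the free object on $\Sigma$ and $\mathbf T\mathbb\Sigma$ the free $\mathbf T$-algebra, with carrier $T\mathbb\Sigma$. *Unary presentation.* A unary operation on $T\mathbb\Sigma$ is a morphism $u:(T\mathbb\Sigma)_s\to(T\mathbb\Sigma)_t$ of $\mathcal D$ with $s,t\in S$. A surjective morphism $e:T\mathbb\Sigma\to B$ of $\mathcal D^S$ is *$\mathcal F$-refinable* if it factorizes through a surjective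 $\mathbf T$-homomorphism $\mathbf T\mathbb\Sigma\to A$ with $A\in\mathcal F$; it is a *$\mathbf T$-quotient* if $B$ carries a $\mathbf T$-algebra structure making $e$ a $\mathbf T$-homomorphism; for a set $\mathbb U$ of unary operations it is a *$\mathbb U$-quotient* if every $u\in\mathbb U$, $u:(T\mathbb\Sigma)_s\to(T\mathbb\Sigma)_t$, has a lifting $u_B:B_s\to B_t$ with $e_t\cdot u=u_B\cdot e_s$. The set $\mathbb U$ is a *unary presentation* of $\mathbf T\mathbb\Sigma$ if an $\mathcal F$-refinable surjective $e$ is a $\mathbf T$-quotient iff it is a $\mathbb U$-quotient. Fix a unary presentation $\mathbb U_\Sigma$ of $\mathbf T\mathbb\Sigma$. *Languages.* Let $\mathbf 1_{\mathcal C},\mathbf 1_{\mathcal D}$ be the free algebras on one generator, $O_{\mathcal D}=P^{-1}\mathbf 1_{\mathcal C}$ and $O_{\mathcal C}=P\mathbf 1_{\mathcal D}$. For every finite $A\in\mathcal D$ there is a canonical bijection $\mathcal D(A,O_{\mathcal D})\cong\mathcal C(\mathbf 1_{\mathcal C},PA)\cong|PA|$, and for $A=\mathbf 1_{\mathcal D}$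 it gives $|O_{\mathcal D}|\cong|O_{\mathcal C}|$. Write $O_{\mathcal D}$ also for the object of $\mathcal D^S$ with $O_{\mathcal D}$ in every sort. A *language* over $\Sigma$ is a morphism $L:T\mathbb\Sigma\to O_{\mathcal D}$ of $\mathcal D^S$; it is *$\mathcal F$-recognizable* if $L=p\cdot h$ for some $\mathbf T$-homomorphism $h:\mathbf T\mathbb\Sigma\to A$ with $A\in\mathcal F$ and some morphism $p:A\to O_{\mathcal D}$ of $\mathcal D^S$. The set $\mathrm{Rec}_{\mathcal F}(\Sigma)$ of $\mathcal F$-recognizable languages is an object of $\mathcal C$, with operations defined pointwise via $|O_{\mathcal D}|\cong|O_{\mathcal C}|$. *Derivatives and diagonals.* For $A\in\mathcal D$ let $\bot:A\to O_{\mathcal D}$ be the composite of the unique morphism from $A$ to the one-element algebra $1$ with the morphism $1\to O_{\mathcal D}$ corresponding to the element $c$ of $P1$. The *derivative* $u^{-1}L$ of a language $L$ with respect to $u:(T\mathbb\Sigma)_s\to(T\mathbb\Sigma)_t$ is the language with $(u^{-1}L)_s=L_t\cdot u$ and $(u^{-1}L)_r=\bot$ for $r\neq s$. The *diagonal* of a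 family $(L^s)_{s\in S}$ of languages is the language with component $(L^s)_s$ in each sort $s$. *Local varieties and local pseudovarieties.* A *local variety of languages over $\Sigma$* is a subobject (i.e. a subalgebra) $W_\Sigma\subseteq\mathrm{Rec}_{\mathcal F}(\Sigma)$ in $\mathcal C$ such that $u^{-1}L\in W_\Sigma$ for all $L\in W_\Sigma$, $u\in\mathbb U_\Sigma$, and the diagonal of every $S$-indexed family of languages in $W_\Sigma$ lies in $W_\Sigma$. A *$\Sigma$-generated $\mathcal F$-algebra* is a surjective $\mathbf T$-homomorphism $e:\mathbf T\mathbb\Sigma\to A$ with $A\in\mathcal F$; these are ordered by $e\le e'$ iff $e$ factorizes through $e'$, and identified if $e\le e'\le e$. A *local pseudovariety of $\Sigma$-generated $\mathcal F$-algebras* is an ideal (nonempty, directed, downward closed subset) of this poset. **Theorem (Local Variety Theorem).** The local varieties of languages over $\Sigma$ and the local pseudovarieties of $\Sigma$-generated $\mathcal F$-algebras, each ordered by inclusion, form lattices, and these two lattices are isomorphic. -/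

import Mathlib

open CategoryTheory

universe u

namespace Eilenberg

/-! ### Varieties of algebras and of ordered algebras -/

/-- A finitary one-sorted signature (a first-order language without relation symbols) together with
a set of inequations `s ≤ t` between terms. If `ordered = true`, this presents a variety of ordered
algebras. If `ordered = false`, it presents a variety of algebras; its algebras are viewed as
discretely ordered, so that `≤` is equality, `s ≤ t` is the equation `s = t`, every homomorphism is
monotone, and order-reflecting maps are the same as injective ones. -/
structure Variety : Type (u + 1) where
  L : FirstOrder.Language.{u, 0}
  [isAlgebraic : L.IsAlgebraic]
  ordered : Bool
  ineqs : Set (L.Term ℕ × L.Term ℕ)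

attribute [instance] Variety.isAlgebraic

namespace Variety

/-- The algebras of a variety. -/
structure Alg (V : Variety.{u}) : Type (u + 1) where
  carrier : Type u
  [str : V.L.Structure carrier]
  [order : PartialOrder carrier]
  monotone_op : ∀ {n : ℕ} (f : V.L.Functions n),
    Monotone (fun x : Fin n → carrier => FirstOrder.Language.Structure.funMap f x)
  discrete : V.ordered = false → ∀ a b : carrier, a ≤ b → a = b
  sat : ∀ p ∈ V.ineqs, ∀ v : ℕ → carrier, p.1.realize v ≤ p.2.realize v

variable {V : Variety.{u}}

instance : CoeSort V.Alg (Type u) := ⟨Alg.carrier⟩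

attribute [instance] Alg.str Alg.order

/-- Morphisms: monotone maps preserving all operations. -/
@[ext]
structure Hom (A B : V.Alg) : Type u where
  toFun : A → B
  monotone' : Monotone toFun
  map_op : ∀ {n : ℕ} (f : V.L.Functions n) (x : Fin n → A),
    toFun (FirstOrder.Language.Structure.funMap f x) = FirstOrder.Language.Structure.funMap f (toFun ∘ x)

instance (A B : V.Alg) : FunLike (Hom A B) A B where
  coe := Hom.toFun
  coe_injective _ _ h := Hom.ext h

instance : Category V.Alg where
  Hom := Hom
  id A := ⟨id, monotone_id, fun _ _ => rfl⟩
  comp f g := ⟨g.toFun ∘ f.toFun, g.monotone'.comp f.monotone', fun s x => by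
    simp [f.map_op, g.map_op, Function.comp_assoc]⟩

instance : ConcreteCategory V.Alg Hom where
  hom f := f
  ofHom f := f

lemma hom_map_op {A B : V.Alg} (h : A ⟶ B) {n : ℕ} (f : V.L.Functions n) (x : Fin n → A) :
    h (FirstOrder.Language.Structure.funMap f x) = FirstOrder.Language.Structure.funMap f (fun i => h (x i)) :=
  Hom.map_op h f x

lemma hom_monotone {A B : V.Alg} (h : A ⟶ B) : Monotone h := Hom.monotone' h

lemma hom_ext {A B : V.Alg} {f g : A ⟶ B} (h : ∀ x, f x = g x) : f = g :=
  Hom.ext (funext h)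

lemma hom_realize {A B : V.Alg} (h : A ⟶ B) {X : Type*} (t : V.L.Term X) (v : X → A) :
    h (t.realize v) = t.realize (fun x => h (v x)) := by
  induction t with
  | var x => rfl
  | func f ts ih =>
    simp only [FirstOrder.Language.Term.realize_func, hom_map_op, ih]

/-- Every finitely generated algebra of the variety is finite. -/
class IsLocallyFinite (V : Variety.{u}) : Prop where
  finite_of_fg : ∀ A : V.Alg, FirstOrder.Language.Structure.FG V.L A → Finite A

/-- The full subcategory of finite algebras. -/
abbrev FinAlg (V : Variety.{u}) : Type (u + 1) :=
  ObjectProperty.FullSubcategory (fun A : V.Alg => Finite A)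

/-! ### Free algebras -/

/-- Terms over `X`, preordered by: `s ≤ t` iff this inequation holds in all algebras of the
variety. -/
def PreFree (V : Variety.{u}) (X : Type u) : Type u := V.L.Term X

instance (V : Variety.{u}) (X : Type u) : Preorder (PreFree V X) where
  le s t := ∀ (A : V.Alg) (v : X → A),
    FirstOrder.Language.Term.realize (L := V.L) v s ≤ FirstOrder.Language.Term.realize (L := V.L) v t
  le_refl _ _ _ := le_rfl
  le_trans _ _ _ h h' A v := (h A v).trans (h' A v)

/-- The carrier of the free algebra on `X`: terms modulo the identities of the variety. -/
def FreeCarrier (V : Variety.{u}) (X : Type u) : Type u :=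
  Antisymmetrization (PreFree V X) (· ≤ ·)

noncomputable instance (V : Variety.{u}) (X : Type u) : PartialOrder (FreeCarrier V X) :=
  inferInstanceAs (PartialOrder (Antisymmetrization (PreFree V X) (· ≤ ·)))

/-- The class of a term. -/
def FreeCarrier.mk {X : Type u} (t : V.L.Term X) : FreeCarrier V X :=
  toAntisymmetrization (α := PreFree V X) (· ≤ ·) t

/-- A term representing an element of the free algebra. -/
noncomputable def FreeCarrier.rep {X : Type u} (a : FreeCarrier V X) : V.L.Term X :=
  ofAntisymmetrization (α := PreFree V X) (· ≤ ·) a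

lemma FreeCarrier.mk_rep {X : Type u} (a : FreeCarrier V X) : mk a.rep = a :=
  toAntisymmetrization_ofAntisymmetrization (α := PreFree V X) (· ≤ ·) a

lemma FreeCarrier.mk_le_mk {X : Type u} {s t : V.L.Term X} :
    (mk s : FreeCarrier V X) ≤ mk t ↔ ∀ (A : V.Alg) (v : X → A), s.realize v ≤ t.realize v :=
  Iff.rfl

lemma FreeCarrier.le_iff {X : Type u} {a b : FreeCarrier V X} :
    a ≤ b ↔ ∀ (A : V.Alg) (v : X → A), a.rep.realize v ≤ b.rep.realize v := by
  rw [← mk_le_mk, mk_rep, mk_rep]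

lemma FreeCarrier.realize_rep_mk {X : Type u} (t : V.L.Term X) (A : V.Alg) (v : X → A) :
    (mk t : FreeCarrier V X).rep.realize v = t.realize v :=
  le_antisymm (mk_le_mk.1 (mk_rep _).le A v) (mk_le_mk.1 (mk_rep _).ge A v)

noncomputable instance (V : Variety.{u}) (X : Type u) : V.L.Structure (FreeCarrier V X) where
  funMap f x := FreeCarrier.mk (FirstOrder.Language.Term.func f fun i => (x i).rep)
  RelMap r := isEmptyElim r

lemma FreeCarrier.realize_rep_realize {X : Type u} {Y : Type*} (t : V.L.Term Y)
    (v : Y → FreeCarrier V X) (A : V.Alg) (w : X → A) :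
    (t.realize v).rep.realize w = t.realize (fun y => (v y).rep.realize w) := by
  induction t with
  | var y => rfl
  | func f ts ih =>
    rw [FirstOrder.Language.Term.realize_func]
    refine (realize_rep_mk _ A w).trans ?_
    simp only [FirstOrder.Language.Term.realize_func, ih]

/-- The free algebra on the set `X`. -/
noncomputable def free (V : Variety.{u}) (X : Type u) : V.Alg where
  carrier := FreeCarrier V X
  monotone_op f x y h := FreeCarrier.mk_le_mk.2 fun A v => by
    simp only [FirstOrder.Language.Term.realize_func]
    exact A.monotone_op f fun i => FreeCarrier.le_iff.1 (h i) A v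
  discrete hV a b h := le_antisymm h <| FreeCarrier.le_iff.2 fun A v =>
    (A.discrete hV _ _ (FreeCarrier.le_iff.1 h A v)).ge
  sat p hp v := FreeCarrier.le_iff.2 fun A w => by
    rw [FreeCarrier.realize_rep_realize, FreeCarrier.realize_rep_realize]
    exact A.sat p hp _

/-- The insertion of generators. -/
def gen {X : Type u} (x : X) : V.free X := FreeCarrier.mk (FirstOrder.Language.Term.var x)

/-- The extension of a map on generators to a morphism. -/
noncomputable def lift {X : Type u} {A : V.Alg} (v : X → A) : V.free X ⟶ A where
  toFun a := (FreeCarrier.rep a).realize v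
  monotone' _ _ h := FreeCarrier.le_iff.1 h A v
  map_op _ _ := FreeCarrier.realize_rep_mk _ A v

lemma lift_gen {X : Type u} {A : V.Alg} (v : X → A) (x : X) : lift v (gen x) = v x :=
  FreeCarrier.realize_rep_mk _ A v

lemma realize_gen {X : Type u} (t : V.L.Term X) :
    t.realize (gen : X → V.free X) = FreeCarrier.mk t := by
  refine le_antisymm (FreeCarrier.le_iff.2 fun A w => ?_) (FreeCarrier.le_iff.2 fun A w => ?_)
  all_goals
    rw [FreeCarrier.realize_rep_mk]
    erw [FreeCarrier.realize_rep_realize]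
    simp only [gen, FreeCarrier.realize_rep_mk, FirstOrder.Language.Term.realize_var]
    exact le_rfl

lemma exists_term {X : Type u} (a : V.free X) : ∃ t : V.L.Term X, a = t.realize gen :=
  ⟨FreeCarrier.rep a, by rw [realize_gen]; exact (FreeCarrier.mk_rep a).symm⟩

lemma free_hom_ext {X : Type u} {A : V.Alg} {f g : V.free X ⟶ A}
    (h : ∀ x, f (gen x) = g (gen x)) : f = g := hom_ext fun a => by
  obtain ⟨t, rfl⟩ := exists_term a
  simp only [hom_realize, h]

/-- The universal property of the free algebra. -/
noncomputable def freeEquiv (X : Type u) (A : V.Alg) : (V.free X ⟶ A) ≃ (X → A) where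
  toFun f x := f (gen x)
  invFun v := lift v
  left_inv _ := free_hom_ext fun _ => lift_gen _ _
  right_inv _ := funext fun _ => lift_gen _ _

instance free_finite [V.IsLocallyFinite] (X : Type u) [Finite X] : Finite (V.free X) := by
  refine IsLocallyFinite.finite_of_fg _ (FirstOrder.Language.Structure.fg_iff.2
    ⟨Set.range gen, Set.finite_range gen, ?_⟩)
  refine eq_top_iff.2 fun a _ => ?_
  obtain ⟨t, rfl⟩ := exists_term a
  exact t.realize_mem _ fun x => FirstOrder.Language.Substructure.subset_closure ⟨x, rfl⟩

/-- The free algebra on one generator, a finite algebra. -/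
noncomputable def freeOne (V : Variety.{u}) [V.IsLocallyFinite] : V.FinAlg :=
  ⟨V.free PUnit, inferInstanceAs (Finite (V.free PUnit))⟩

/-! ### Products -/

/-- The product of a family of algebras. -/
def prod {ι : Type} (A : ι → V.Alg) : V.Alg where
  carrier := ∀ i, A i
  str := { funMap := fun f x i => FirstOrder.Language.Structure.funMap f fun k => x k i
           RelMap := fun r => isEmptyElim r }
  monotone_op f x y h i := (A i).monotone_op f
    (fun k => (h : ∀ k, x k ≤ y k) k i)
  discrete hV a b h := funext fun i => (A i).discrete hV _ _ (h i)
  sat p hp v i := by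
    let _ : V.L.Structure (∀ i, A i) :=
      { funMap := fun f x i => FirstOrder.Language.Structure.funMap f fun k => x k i
        RelMap := fun r => isEmptyElim r }
    have key : ∀ t : V.L.Term ℕ, t.realize v i = t.realize (fun n => v n i) := by
      intro t
      induction t with
      | var n => rfl
      | func f ts ih =>
        simp only [FirstOrder.Language.Term.realize_func, ← ih]
        rfl
    change p.1.realize v i ≤ p.2.realize v i
    rw [key, key]
    exact (A i).sat p hp _

/-- The one-element algebra (the empty product). -/
def one (V : Variety.{u}) : V.FinAlg :=
  ⟨V.prod (fun i : Empty => i.elim), inferInstanceAs (Finite (∀ i : Empty, (i.elim : V.Alg)))⟩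

/-- The unique morphism into the one-element algebra. -/
def toOne (A : V.Alg) : A ⟶ V.one.obj where
  toFun _ i := i.elim
  monotone' _ _ _ i := i.elim
  map_op _ _ := funext fun i => i.elim

end Variety

/-! ### Algebras for a monad on `D^S` -/

variable {S : Type} {D C : Variety.{u}}

/-- A morphism of `D^S` is surjective if it is so in every sort. -/
def Surj {X Y : S → D.Alg} (f : X ⟶ Y) : Prop :=
  ∀ s, Function.Surjective (f s)

/-- A morphism of `D^S` is order-reflecting (in the unordered case: injective) if it is so in every
sort. -/
def OrderReflecting {X Y : S → D.Alg} (f : X ⟶ Y) : Prop :=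
  ∀ s (a b : X s), f s a ≤ f s b → a ≤ b

/-- A class of finite `T`-algebras closed under quotients, subalgebras and finite products. -/
class IsRecognizerClass {T : Monad (S → D.Alg)} (F : ObjectProperty T.Algebra) : Prop
    extends F.IsClosedUnderFiniteProducts where
  finite : ∀ A : T.Algebra, F A → ∀ s, Finite (A.A s)
  of_quotient : ∀ {A B : T.Algebra} (e : A ⟶ B), Surj e.f → F A → F B
  of_subalgebra : ∀ {A B : T.Algebra} (m : A ⟶ B), OrderReflecting m.f → F B → F A

section Presentations

variable {T : Monad (S → D.Alg)}

/-- The quotients of the `T`-algebra `A` with codomain in `F`. -/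
structure Quo (F : ObjectProperty T.Algebra) (A : T.Algebra) where
  cod : T.Algebra
  mem : F cod
  hom : A ⟶ cod
  surj : Surj hom.f

/-- `e ≤ e'` iff `e` factorizes through `e'`. -/
instance (F : ObjectProperty T.Algebra) (A : T.Algebra) : Preorder (Quo F A) where
  le e e' := ∃ q : e'.cod ⟶ e.cod, e.hom = e'.hom ≫ q
  le_refl e := ⟨𝟙 _, (Category.comp_id _).symm⟩
  le_trans := by
    rintro a b c ⟨q, hq⟩ ⟨r, hr⟩
    exact ⟨r ≫ q, by rw [hq, hr, Category.assoc]⟩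

/-- The surjective morphism `e` of `D^S` carries a quotient `T`-algebra of `A`. -/
def IsTQuotient (A : T.Algebra) {B : S → D.Alg} (e : A.A ⟶ B) : Prop :=
  ∃ β : T.obj B ⟶ B, T.η.app B ≫ β = 𝟙 B ∧ T.μ.app B ≫ β = T.map β ≫ β ∧
    T.map e ≫ β = A.a ≫ e

/-- `e` factorizes through a quotient `T`-algebra of `A` in `F`. -/
def IsRefinable (F : ObjectProperty T.Algebra) (A : T.Algebra) {B : S → D.Alg} (e : A.A ⟶ B) :
    Prop :=
  ∃ (q : Quo F A) (p : q.cod.A ⟶ B), e = q.hom.f ≫ p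

/-- Unary operations `X s ⟶ X t` on an object of `D^S`, for arbitrary sorts `s` and `t`. -/
abbrev UnaryOp (X : S → D.Alg) : Type u := Σ s t : S, X s ⟶ X t

/-- Every operation in `U` lifts along `e`. -/
def IsUQuotient {X B : S → D.Alg} (U : Set (UnaryOp X)) (e : X ⟶ B) : Prop :=
  ∀ u ∈ U, ∃ v : B u.1 ⟶ B u.2.1, u.2.2 ≫ e u.2.1 = e u.1 ≫ v

/-- `U` is a unary presentation of `A`: among the `F`-refinable quotients of `A` in `D^S`, the
`T`-quotients are exactly the `U`-quotients. -/
def IsUnaryPresentation (F : ObjectProperty T.Algebra) (A : T.Algebra) (U : Set (UnaryOp A.A)) :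
    Prop :=
  ∀ (B : S → D.Alg) (e : A.A ⟶ B), Surj e → IsRefinable F A e →
    (IsTQuotient A e ↔ IsUQuotient U e)

/-- The free `T`-algebra generated by an `S`-sorted alphabet. -/
noncomputable abbrev freeAlg (T : Monad (S → D.Alg)) (Al : S → Type u) : T.Algebra :=
  T.free.obj (fun s => D.free (Al s))

/-- Local pseudovarieties of `Al`-generated `F`-algebras: ideals (nonempty directed downwards
closed subsets) of the poset of quotients of the free `T`-algebra with codomain in `F`. -/
abbrev LocalPseudovariety (F : ObjectProperty T.Algebra) (Al : S → Type u) : Type _ :=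
  Order.Ideal (Antisymmetrization (Quo F (freeAlg T Al)) (· ≤ ·))

/-- `T`-algebras have finite products, computed sortwise in `D`. -/
lemma hasProduct {ι : Type} (A : ι → T.Algebra) : Limits.HasProduct A := by
  have : Limits.HasLimit (Discrete.functor A ⋙ T.forget) := ⟨⟨{
    cone :=
      { pt := fun s => Variety.prod fun i => (A i).A s
        π := Discrete.natTrans fun i s =>
          { toFun := fun x => x i.as
            monotone' := fun _ _ h => h i.as
            map_op := fun _ _ => rfl } }
    isLimit :=
      { lift := fun c s =>
          { toFun := fun x i => c.π.app ⟨i⟩ s x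
            monotone' := fun _ _ h i => Variety.hom_monotone (c.π.app ⟨i⟩ s) h
            map_op := fun f x => funext fun i => Variety.hom_map_op (c.π.app ⟨i⟩ s) f x }
        fac := fun c i => rfl
        uniq := fun c m hm => by
          funext s
          refine Variety.hom_ext fun x => funext fun i => ?_
          exact congrArg (fun k : c.pt ⟶ (A i).A => k s x) (hm ⟨i⟩) } }⟩⟩
  exact Monad.hasLimit_of_comp_forget_hasLimit _

end Presentations

/-! ### The objects of outputs -/

section Duality

variable [C.IsLocallyFinite] (Δ : D.FinAlgᵒᵖ ≌ C.FinAlg)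

/-- The object of outputs `O_D`, the dual of the free `C`-algebra on one generator. -/
noncomputable def outD : D.FinAlg := (Δ.inverse.obj C.freeOne).unop

/-- For a finite `D`-algebra `A`, the morphisms `A ⟶ O_D` correspond to the elements of the dual
`P A` of `A`, by `D(A, P⁻¹ 1) ≃ C(1, P A) ≃ |P A|`. -/
noncomputable def dualElem (A : D.FinAlg) :
    (A.obj ⟶ (outD Δ).obj) ≃ (Δ.functor.obj (Opposite.op A)).obj :=
  (InducedCategory.homEquiv (X := A) (Y := outD Δ)).symm.trans <|
    (opEquiv (Δ.inverse.obj C.freeOne) (Opposite.op A)).symm.trans <|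
      (Δ.symm.toAdjunction.homEquiv C.freeOne (Opposite.op A)).trans <|
        InducedCategory.homEquiv.trans <|
          (Variety.freeEquiv PUnit _).trans (Equiv.funUnique PUnit _)

lemma dualElem_comp {A B : D.FinAlg} (g : A.obj ⟶ B.obj) (f : B.obj ⟶ (outD Δ).obj) :
    dualElem Δ A (g ≫ f) =
      (Δ.functor.map (ObjectProperty.homMk (X := A) (Y := B) g).op).hom (dualElem Δ B f) := by
  have h := Δ.symm.toAdjunction.homEquiv_naturality_right (X := C.freeOne)
    (ObjectProperty.homMk (X := B) (Y := outD Δ) f).op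
    (ObjectProperty.homMk (X := A) (Y := B) g).op
  exact congrArg (fun k => k.hom (Variety.gen PUnit.unit)) h

variable [D.IsLocallyFinite]

/-- The object of outputs `O_C`, the dual of the free `D`-algebra on one generator. -/
noncomputable def outC : C.FinAlg := Δ.functor.obj (Opposite.op D.freeOne)

/-- The canonical bijection `|O_D| ≃ D(1, O_D) ≃ |P 1| = |O_C|`. -/
noncomputable def outEquiv : (outD Δ).obj ≃ (outC Δ).obj :=
  (((Variety.freeEquiv PUnit (outD Δ).obj).trans (Equiv.funUnique PUnit _)).symm).trans
    (dualElem Δ D.freeOne)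

lemma outEquiv_apply (A : D.FinAlg) (g : A.obj ⟶ (outD Δ).obj) (a : A.obj) :
    outEquiv Δ (g a) = (Δ.functor.map (ObjectProperty.homMk (X := D.freeOne) (Y := A)
      (Variety.lift fun _ => a)).op).hom (dualElem Δ A g) := by
  refine Eq.trans ?_ (dualElem_comp Δ (A := D.freeOne) (B := A) (Variety.lift fun _ => a) g)
  refine congrArg (dualElem Δ D.freeOne) (Variety.free_hom_ext fun x => ?_)
  refine (Variety.lift_gen _ x).trans ?_
  exact congrArg g (Variety.lift_gen (fun _ => a) x).symm

/-- Let `f` be an operation symbol of `C`. Under the bijection between morphisms `A ⟶ O_D` and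
elements of the dual `P A`, the operation `f` of `P A` becomes the pointwise operation `f`
of `O_C`. -/
lemma outEquiv_op (A : D.FinAlg) {n : ℕ} (f : C.L.Functions n)
    (q : Fin n → (A.obj ⟶ (outD Δ).obj)) (a : A.obj) :
    outEquiv Δ ((dualElem Δ A).symm
      (FirstOrder.Language.Structure.funMap f fun i => dualElem Δ A (q i)) a) =
      FirstOrder.Language.Structure.funMap f fun i => outEquiv Δ (q i a) := by
  rw [outEquiv_apply, Equiv.apply_symm_apply, Variety.hom_map_op]
  simp only [outEquiv_apply]
  rfl

/-! ### Recognizable languages -/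

variable {T : Monad (S → D.Alg)}

/-- Languages over the alphabet `Al`: morphisms from the free algebra to the object which has `O_D`
in every sort. -/
abbrev Lang (T : Monad (S → D.Alg)) (Al : S → Type u) : Type u :=
  (freeAlg T Al).A ⟶ fun _ => (outD Δ).obj

/-- `L` is recognized by some algebra in `F`. -/
def IsRecognizable (F : ObjectProperty T.Algebra) {Al : S → Type u} (L : Lang Δ T Al) : Prop :=
  ∃ (A : T.Algebra) (_ : F A) (h : freeAlg T Al ⟶ A) (p : A.A ⟶ fun _ => (outD Δ).obj),
    L = h.f ≫ p

/-- The set of `F`-recognizable languages over `Al`. -/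
def Rec (F : ObjectProperty T.Algebra) (Al : S → Type u) : Type u :=
  {L : Lang Δ T Al // IsRecognizable Δ F L}

variable (F : ObjectProperty T.Algebra) (Al : S → Type u)

namespace Rec

variable {Δ F Al}

/-- The value of a recognizable language at `x`, as an element of `O_C`. -/
noncomputable def eval (L : Rec Δ F Al) (s : S) (x : (freeAlg T Al).A s) : (outC Δ).obj :=
  outEquiv Δ (L.1 s x)

lemma eval_injective :
    Function.Injective (fun (L : Rec Δ F Al) s x => L.eval s x) := fun L M h =>
  Subtype.ext <| funext fun s => Variety.hom_ext fun x =>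
    (outEquiv Δ).injective (congrFun (congrFun h s) x)

/-- Recognizable languages are closed under the pointwise operations of `O_C`. -/
lemma exists_op [IsRecognizerClass F] {n : ℕ} (f : C.L.Functions n) (L : Fin n → Rec Δ F Al) :
    ∃ M : Rec Δ F Al, ∀ s x,
      M.eval s x = FirstOrder.Language.Structure.funMap f fun i => (L i).eval s x := by
  choose A hA h p hL using fun i => (L i).2
  have := hasProduct A
  let P : T.Algebra := ∏ᶜ A
  have hP : F P := ObjectProperty.prop_pi F A hA
  have hfin : ∀ s, Finite (P.A s) := IsRecognizerClass.finite P hP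
  let g : freeAlg T Al ⟶ P := Limits.Pi.lift h
  let q : ∀ i, P.A ⟶ fun _ => (outD Δ).obj := fun i => (Limits.Pi.π A i).f ≫ p i
  have hq : ∀ i, (L i).1 = g.f ≫ q i := fun i => by
    rw [hL i, ← Limits.Pi.lift_π h i]
    exact Category.assoc _ _ _
  let r : P.A ⟶ fun _ => (outD Δ).obj := fun s => (dualElem Δ ⟨P.A s, hfin s⟩).symm
    (FirstOrder.Language.Structure.funMap f fun i => dualElem Δ ⟨P.A s, hfin s⟩ (q i s))
  refine ⟨⟨g.f ≫ r, P, hP, g, r, rfl⟩, fun s x => ?_⟩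
  refine (outEquiv_op Δ ⟨P.A s, hfin s⟩ f (fun i => q i s) (g.f s x)).trans ?_
  refine congrArg _ (funext fun i => ?_)
  rw [eval, hq i]
  rfl

variable [IsRecognizerClass F]

noncomputable instance : C.L.Structure (Rec Δ F Al) where
  funMap f L := (exists_op f L).choose
  RelMap r := isEmptyElim r

lemma eval_funMap {n : ℕ} (f : C.L.Functions n) (L : Fin n → Rec Δ F Al) (s : S)
    (x : (freeAlg T Al).A s) :
    (FirstOrder.Language.Structure.funMap f L : Rec Δ F Al).eval s x =
      FirstOrder.Language.Structure.funMap f fun i => (L i).eval s x :=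
  (exists_op f L).choose_spec s x

lemma eval_realize {X : Type*} (t : C.L.Term X) (v : X → Rec Δ F Al) (s : S)
    (x : (freeAlg T Al).A s) :
    (t.realize v).eval s x = t.realize fun y => (v y).eval s x := by
  induction t with
  | var y => rfl
  | func f ts ih => simp only [FirstOrder.Language.Term.realize_func, eval_funMap, ih]

noncomputable instance : PartialOrder (Rec Δ F Al) :=
  PartialOrder.lift (fun (L : Rec Δ F Al) s x => L.eval s x) eval_injective

end Rec

/-- The set of `F`-recognizable languages as an object of `C`: the operations of `C` are defined
pointwise, via the bijection `|O_D| ≃ |O_C|`. Thus it is a subobject of the product of the powers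
`O_C ^ |(T Al) s|` over the sorts `s`. -/
noncomputable def recAlg [IsRecognizerClass F] : C.Alg where
  carrier := Rec Δ F Al
  monotone_op f _ _ h s x := by
    simp only [Rec.eval_funMap]
    exact (outC Δ).obj.monotone_op f fun i => h i s x
  discrete hC _ _ h := Rec.eval_injective <| funext fun s => funext fun x =>
    (outC Δ).obj.discrete hC _ _ (h s x)
  sat p hp v s x := by
    simp only [Rec.eval_realize]
    exact (outC Δ).obj.sat p hp _

/-! ### Local varieties of languages -/

section

variable {Δ F Al}

/-- The component `⊥ : A ⟶ O_D` of the natural transformation that is dual to the one which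
chooses the constant `c` in every algebra of `C`. For finite `A` it is the morphism corresponding
to the element `c` of the dual `P A`; by naturality, in general it is the composite
`A ⟶ 1 ⟶ O_D`, where `1` is the one-element algebra. -/
noncomputable def bot (c : C.L.Constants) (A : D.Alg) : A ⟶ (outD Δ).obj :=
  Variety.toOne A ≫ (dualElem Δ D.one).symm (c : (Δ.functor.obj (Opposite.op D.one)).obj)

open Classical in
/-- The derivative of the language `L` w.r.t. the unary operation `u` from sort `s` to sort `t`:
it is `u ≫ L t` in sort `s` and `⊥` in all other sorts. -/
noncomputable def deriv (c : C.L.Constants) (u : UnaryOp (freeAlg T Al).A) (L : Lang Δ T Al) :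
    Lang Δ T Al :=
  Function.update (β := fun s => (freeAlg T Al).A s ⟶ (outD Δ).obj) (fun _ => bot c _)
    u.1 (u.2.2 ≫ L u.2.1)

/-- The diagonal of an `S`-indexed family of languages. -/
def diag (K : S → Lang Δ T Al) : Lang Δ T Al := fun s => K s s

end

/-- Local varieties of languages over `Al`: subobjects of `recAlg` in `C` (i.e. subsets closed under
the operations of `C`) that are closed under derivatives w.r.t. the operations in `U` and under
diagonals. -/
@[ext]
structure LocalVariety [IsRecognizerClass F] (c : C.L.Constants)
    (U : Set (UnaryOp (freeAlg T Al).A)) : Type u where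
  toSub : C.L.Substructure (recAlg Δ F Al)
  deriv_mem : ∀ L : Rec Δ F Al, L ∈ toSub → ∀ u ∈ U, ∃ M : Rec Δ F Al, M ∈ toSub ∧
    M.1 = deriv c u L.1
  diag_mem : ∀ K : S → Rec Δ F Al, (∀ s, K s ∈ toSub) → ∃ M : Rec Δ F Al, M ∈ toSub ∧
    M.1 = diag fun s => (K s).1

/-- Local varieties are ordered by inclusion. -/
noncomputable instance [IsRecognizerClass F] (c : C.L.Constants) (U : Set (UnaryOp (freeAlg T Al).A)) :
    PartialOrder (LocalVariety Δ F Al c U) :=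
  PartialOrder.lift LocalVariety.toSub fun _ _ => LocalVariety.ext

end Duality

/-- Every two elements have a supremum and an infimum. -/
def IsLatticeOrder (P : Type*) [PartialOrder P] : Prop :=
  ∀ a b : P, (∃ c, IsLUB {a, b} c) ∧ ∃ c, IsGLB {a, b} c

end Eilenberg

/-!
Local varieties of languages correspond to local pseudovarieties of quotients of the free
`T`-algebra. A local pseudovariety is sent to the languages recognized by its members, and a local
variety `W` to the quotients `e` all of whose recognized languages `e ≫ p` lie in `W`.

The duality enters through the identification of the morphisms `A ⟶ O_D`, for a finite algebra `A`
of `D`, with the elements of the dual of `A`. It has three consequences. The object `O_D`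
cogenerates the finite algebras, in the strong sense that morphisms to it jointly reflect the order
(`le_of_forall_out`). Every subalgebra of the dual of `A` consists of the morphisms that factorize
through some quotient of `A` (`exists_dual_quotient`); here the surjectivity of epimorphisms is
needed. The dual of a subdirect product is generated by the duals of the factors
(`eq_top_of_reflecting`).

The subdirect product of finitely many quotients is a common refinement of them
(`exists_subdirect`), and it recognizes only languages generated by those recognized by the factors.
So the quotients assigned to `W` form an ideal (`LocalVariety.toIdeal`). Conversely, the languages
recognized by a fixed quotient are closed under the operations of `C` and under diagonals, and
under derivatives because a `T`-quotient is a `U`-quotient. Directedness carries this over to an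
ideal (`LocalPseudovariety.toVariety`).

The two assignments are mutually inverse. An ideal is recovered since a quotient is determined by
its finitely many recognized languages (`le_of_recLang`). To recover `W`, start with a language in
`W` and a quotient recognizing it, with codomain `A`. In every sort, the predicates on `A` that
define languages in `W` form a subalgebra of the dual of `A`, so they determine a quotient of `A`.
Closure of `W` under derivatives says that the resulting quotient of the free algebra is a
`U`-quotient. By the unary presentation it is a `T`-quotient
(`LocalVariety.exists_contains_of_mem`).

Local varieties are closed under nonempty intersections, and the ideal of all quotients provides a
largest one. So they form a lattice, and the isomorphism transfers this to local pseudovarieties.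
-/

/-! ### Images, subalgebras and factorizations in a variety -/

namespace Eilenberg

namespace Variety

variable {V : Variety.{u}}

instance finite_hom {A B : V.Alg} [Finite A] [Finite B] : Finite (A ⟶ B) :=
  Finite.of_injective (fun f : A ⟶ B => (f : A → B)) fun _ _ h => hom_ext (congrFun h)

/-- A morphism `g` that is at least as coarse as a surjection `f` factorizes through it. -/
lemma exists_factor {A B E : V.Alg} {f : A ⟶ B} (hf : Function.Surjective f) (g : A ⟶ E)
    (h : ∀ x y, f x ≤ f y → g x ≤ g y) : ∃ q : B ⟶ E, g = f ≫ q := by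
  choose r hr using hf
  have key : ∀ x, g (r (f x)) = g x := fun x =>
    le_antisymm (h _ _ (hr _).le) (h _ _ (hr _).ge)
  refine ⟨⟨fun b => g (r b), fun b b' hb => h _ _ (by rwa [hr, hr]), fun k x => ?_⟩,
    hom_ext fun x => (key x).symm⟩
  have hx : x = fun i => f (r (x i)) := funext fun i => (hr _).symm
  conv_lhs => rw [hx, ← hom_map_op, key, hom_map_op]
  rfl

lemma exists_lift_of_reflecting {A B E : V.Alg} {m : B ⟶ E} (hm : ∀ x y, m x ≤ m y → x ≤ y)
    (g : A ⟶ E) (h : ∀ x, ∃ y, m y = g x) : ∃ q : A ⟶ B, q ≫ m = g := by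
  choose r hr using h
  refine ⟨⟨r, fun x y hxy => hm _ _ ?_, fun k x => ?_⟩, hom_ext hr⟩
  · rw [hr, hr]
    exact hom_monotone g hxy
  · have : m (r (FirstOrder.Language.Structure.funMap k x)) =
        m (FirstOrder.Language.Structure.funMap k (r ∘ x)) := by
      rw [hr, hom_map_op, hom_map_op]
      simp only [Function.comp_apply, hr]
    exact le_antisymm (hm _ _ this.le) (hm _ _ this.ge)

/-- The subalgebra given by a subset closed under the operations, with the induced order. -/
def subAlg {A : V.Alg} (W : V.L.Substructure A) : V.Alg where
  carrier := W
  monotone_op f _ _ h := A.monotone_op f h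
  discrete hV a b h := Subtype.ext (A.discrete hV _ _ h)
  sat p hp v := by
    change W.subtype (p.1.realize v) ≤ W.subtype (p.2.realize v)
    rw [← FirstOrder.Language.HomClass.realize_term, ← FirstOrder.Language.HomClass.realize_term]
    exact A.sat p hp _

/-- The inclusion of a subalgebra. -/
def subAlg.incl {A : V.Alg} (W : V.L.Substructure A) : subAlg W ⟶ A where
  toFun x := x.1
  monotone' _ _ h := h
  map_op _ _ := rfl

/-- The product of a family of algebras indexed by a set in the universe of the algebras. -/
def bigProd {ι : Type u} (A : ι → V.Alg) : V.Alg where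
  carrier := ∀ i, A i
  str := { funMap := fun f x i => FirstOrder.Language.Structure.funMap f fun k => x k i
           RelMap := fun r => isEmptyElim r }
  monotone_op f x y h i := (A i).monotone_op f
    (fun k => (h : ∀ k, x k ≤ y k) k i)
  discrete hV a b h := funext fun i => (A i).discrete hV _ _ (h i)
  sat p hp v i := by
    let _ : V.L.Structure (∀ i, A i) :=
      { funMap := fun f x i => FirstOrder.Language.Structure.funMap f fun k => x k i
        RelMap := fun r => isEmptyElim r }
    have key : ∀ t : V.L.Term ℕ, t.realize v i = t.realize (fun n => v n i) := by
      intro t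
      induction t with
      | var n => rfl
      | func f ts ih =>
        simp only [FirstOrder.Language.Term.realize_func, ← ih]
        rfl
    change p.1.realize v i ≤ p.2.realize v i
    rw [key, key]
    exact (A i).sat p hp _

/-- A family of morphisms with a common domain factorizes into a surjective morphism followed by a
family that jointly reflects the order. -/
lemma exists_image {ι : Type u} {A : V.Alg} {B : ι → V.Alg} (f : ∀ i, A ⟶ B i) :
    ∃ (I : V.Alg) (e : A ⟶ I) (m : ∀ i, I ⟶ B i), Function.Surjective e ∧
      (∀ i, f i = e ≫ m i) ∧ ∀ x y, (∀ i, m i x ≤ m i y) → x ≤ y := by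
  let g : A ⟶ bigProd B :=
    { toFun := fun a i => f i a
      monotone' := fun _ _ h i => hom_monotone (f i) h
      map_op := fun k x => funext fun i => hom_map_op (f i) k x }
  let W : V.L.Substructure (bigProd B) :=
    { carrier := Set.range g
      fun_mem := fun k x hx => by
        choose y hy using hx
        exact ⟨FirstOrder.Language.Structure.funMap k y, by rw [hom_map_op]; simp only [hy]⟩ }
  let π : ∀ i, bigProd B ⟶ B i := fun i =>
    { toFun := fun x => x i
      monotone' := fun _ _ h => h i
      map_op := fun _ _ => rfl }
  let e : A ⟶ subAlg W :=
    { toFun := fun a => ⟨g a, a, rfl⟩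
      monotone' := fun _ _ h => hom_monotone g h
      map_op := fun k x => Subtype.ext (hom_map_op g k x) }
  exact ⟨subAlg W, e, fun i => subAlg.incl W ≫ π i, fun ⟨_, a, ha⟩ => ⟨a, Subtype.ext ha⟩,
    fun _ => rfl, fun x y h => h⟩

/-- To prove that `f` is an epimorphism, it suffices in a locally finite variety to test it on
finite algebras, provided that the codomain `B` of `f` is finite: two morphisms `B ⟶ Z` factorize
through the subalgebra of `Z` generated by their images. -/
lemma epi_of_finite [V.IsLocallyFinite] {A B : V.Alg} [Finite B] (f : A ⟶ B)
    (h : ∀ (E : V.Alg) [Finite E] (g g' : B ⟶ E), f ≫ g = f ≫ g' → g = g') : Epi f := by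
  refine ⟨fun {Z} g g' hg => ?_⟩
  let W : V.L.Substructure Z := FirstOrder.Language.Substructure.closure V.L
    (Set.range g ∪ Set.range g')
  have hfg : W.FG := (FirstOrder.Language.Substructure.fg_def).2
    ⟨_, (Set.finite_range g).union (Set.finite_range g'), rfl⟩
  have : Finite (subAlg W) := IsLocallyFinite.finite_of_fg _
    ((FirstOrder.Language.Substructure.fg_iff_structure_fg W).1 hfg)
  let k : B ⟶ subAlg W :=
    { toFun := fun b => ⟨g b, FirstOrder.Language.Substructure.subset_closure (Or.inl ⟨b, rfl⟩)⟩
      monotone' := fun _ _ hb => hom_monotone g hb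
      map_op := fun s x => Subtype.ext (hom_map_op g s x) }
  let k' : B ⟶ subAlg W :=
    { toFun := fun b => ⟨g' b, FirstOrder.Language.Substructure.subset_closure (Or.inr ⟨b, rfl⟩)⟩
      monotone' := fun _ _ hb => hom_monotone g' hb
      map_op := fun s x => Subtype.ext (hom_map_op g' s x) }
  have hk : k = k' := h _ k k' <| hom_ext fun a => Subtype.ext
    (congrArg (fun l : A ⟶ Z => l a) hg)
  exact congrArg (fun l => l ≫ subAlg.incl W) hk

lemma isIso_of_reflecting {A B : V.Alg} (f : A ⟶ B) (hf : Function.Surjective f)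
    (h : ∀ x y, f x ≤ f y → x ≤ y) : IsIso f := by
  obtain ⟨g, hg⟩ := exists_factor hf (𝟙 A) h
  refine ⟨g, hg.symm, hom_ext fun b => ?_⟩
  obtain ⟨a, rfl⟩ := hf b
  exact congrArg (fun l : A ⟶ A => f (l a)) hg.symm

lemma FinAlg.isIso_of_reflecting {A B : V.FinAlg} (f : A ⟶ B) (hf : Function.Surjective f.hom)
    (h : ∀ x y, f.hom x ≤ f.hom y → x ≤ y) : IsIso f := by
  have := Variety.isIso_of_reflecting f.hom hf h
  exact ⟨ObjectProperty.homMk (inv f.hom), ObjectProperty.hom_ext _ (IsIso.hom_inv_id f.hom),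
    ObjectProperty.hom_ext _ (IsIso.inv_hom_id f.hom)⟩

lemma FinAlg.reflecting_of_isIso {A B : V.FinAlg} (f : A ⟶ B) [IsIso f] {x y : A.obj}
    (h : f.hom x ≤ f.hom y) : x ≤ y := by
  have hf : f.hom ≫ (inv f).hom = 𝟙 _ := congrArg (fun k => k.hom) (IsIso.hom_inv_id f)
  have hx : ∀ z, (inv f).hom (f.hom z) = z := fun z => congrArg (fun k : A.obj ⟶ A.obj => k z) hf
  rw [← hx x, ← hx y]
  exact hom_monotone _ h

end Variety

/-! ### The duality and the object of outputs -/

section Duality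

open Variety

variable {D C : Variety.{u}} [C.IsLocallyFinite] (Δ : D.FinAlgᵒᵖ ≌ C.FinAlg)

lemma dualElem_comp_hom {A B : D.FinAlg} (g : A ⟶ B) (f : B.obj ⟶ (outD Δ).obj) :
    dualElem Δ A (g.hom ≫ f) = (Δ.functor.map g.op).hom (dualElem Δ B f) :=
  dualElem_comp Δ g.hom f

/-- The object of outputs cogenerates the finite algebras. The factorization `k` of all morphisms
from `A` to it induces a bijection on morphisms to it. So `k` is dual to a bijective morphism of
`C`. That is an isomorphism because `C` is unordered, hence so is `k`. -/
lemma le_of_forall_out (hC : C.ordered = false) (A : D.FinAlg) (x y : A.obj)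
    (h : ∀ p : A.obj ⟶ (outD Δ).obj, p x ≤ p y) : x ≤ y := by
  obtain ⟨I, k, m, hk, hm, hI⟩ := exists_image
    (fun p : A.obj ⟶ (outD Δ).obj => p)
  have := A.property
  let J : D.FinAlg := ⟨I, Finite.of_surjective k hk⟩
  let k' : A ⟶ J := ObjectProperty.homMk k
  have hbij : Function.Bijective (Δ.functor.map k'.op).hom := by
    constructor
    · intro a b hab
      obtain ⟨p, rfl⟩ := (dualElem Δ J).surjective a
      obtain ⟨q, rfl⟩ := (dualElem Δ J).surjective b
      rw [← dualElem_comp_hom, ← dualElem_comp_hom] at hab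
      have hpq := (dualElem Δ A).injective hab
      refine congrArg _ (hom_ext fun z => ?_)
      obtain ⟨z, rfl⟩ := hk z
      exact congrArg (fun l : A.obj ⟶ (outD Δ).obj => l z) hpq
    · intro a
      obtain ⟨p, rfl⟩ := (dualElem Δ A).surjective a
      refine ⟨dualElem Δ J (m p), ?_⟩
      rw [← dualElem_comp_hom]
      exact congrArg _ (hm p).symm
  have h1 : IsIso (Δ.functor.map k'.op) := FinAlg.isIso_of_reflecting _ hbij.2 fun a b hab =>
    (hbij.1 ((Δ.functor.obj (Opposite.op A)).obj.discrete hC _ _ hab)).le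
  have h2 : IsIso k'.op := isIso_of_reflects_iso _ Δ.functor
  have h3 : IsIso k' := (isIso_op_iff k').1 h2
  refine FinAlg.reflecting_of_isIso k' (hI _ _ fun p => ?_)
  have := h p
  rwa [hm p] at this

/-- Subalgebras of the dual of `A` correspond to quotients of `A`. The morphism dual to the
inclusion of `W` is an epimorphism, because morphisms out of its codomain are separated by the
object of outputs. -/
lemma exists_dual_quotient [D.IsLocallyFinite] (hC : C.ordered = false)
    (hepi : ∀ (A B : D.Alg) (f : A ⟶ B), Epi f → Function.Surjective f) (A : D.FinAlg)
    (W : C.L.Substructure (Δ.functor.obj (Opposite.op A)).obj) :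
    ∃ (Q : D.FinAlg) (k : A.obj ⟶ Q.obj), Function.Surjective k ∧
      ∀ p : A.obj ⟶ (outD Δ).obj, (∃ p', p = k ≫ p') ↔ dualElem Δ A p ∈ W := by
  have := (Δ.functor.obj (Opposite.op A)).property
  let W' : C.FinAlg := ⟨subAlg W, inferInstanceAs (Finite W)⟩
  let i : W' ⟶ Δ.functor.obj (Opposite.op A) := ObjectProperty.homMk (subAlg.incl W)
  let φ := Δ.functor.objObjPreimageIso W'
  let k' := Δ.functor.preimage (φ.hom ≫ i)
  let Q : D.FinAlg := (Δ.functor.objPreimage W').unop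
  let k : A ⟶ Q := k'.unop
  have hk : ∀ p, dualElem Δ A (k.hom ≫ p) = (φ.hom.hom (dualElem Δ Q p)).1 := fun p => by
    rw [dualElem_comp_hom]
    exact congrArg (fun l => l.hom (dualElem Δ Q p)) (Δ.functor.map_preimage (φ.hom ≫ i))
  have hφ : ∀ z, φ.hom.hom (φ.inv.hom z) = z := fun z =>
    congrArg (fun l => l.hom z) φ.inv_hom_id
  have hφ' : ∀ z, φ.inv.hom (φ.hom.hom z) = z := fun z =>
    congrArg (fun l => l.hom z) φ.hom_inv_id
  have hinj : ∀ p q, k.hom ≫ p = k.hom ≫ q → p = q := fun p q h => by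
    have h1 := congrArg (dualElem Δ A) h
    rw [hk, hk] at h1
    have h2 := congrArg φ.inv.hom (Subtype.ext h1)
    rw [hφ', hφ'] at h2
    exact (dualElem Δ Q).injective h2
  have := Q.property
  refine ⟨Q, k.hom, hepi _ _ _ (epi_of_finite _ fun E hE g g' hg => ?_),
    fun p => ⟨?_, fun hp => ?_⟩⟩
  · have key : ∀ p : E ⟶ (outD Δ).obj, g ≫ p = g' ≫ p := fun p => hinj _ _ <| by
      rw [← Category.assoc, hg, Category.assoc]
    refine hom_ext fun x => le_antisymm ?_ ?_
    · exact le_of_forall_out Δ hC ⟨E, hE⟩ _ _ fun p =>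
        (congrArg (fun l : Q.obj ⟶ (outD Δ).obj => l x) (key p)).le
    · exact le_of_forall_out Δ hC ⟨E, hE⟩ _ _ fun p =>
        (congrArg (fun l : Q.obj ⟶ (outD Δ).obj => l x) (key p)).ge
  · rintro ⟨p', rfl⟩
    rw [hk]
    exact Subtype.property _
  · refine ⟨(dualElem Δ Q).symm (φ.inv.hom ⟨_, hp⟩), (dualElem Δ A).injective ?_⟩
    rw [hk, Equiv.apply_symm_apply]
    exact (congrArg Subtype.val (hφ ⟨_, hp⟩)).symm

/-- If the morphisms `q i` out of `B` jointly reflect the order, then the dual of `B` is generated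
by the elements corresponding to the morphisms `q i ≫ p`. Indeed, the quotient of `B` dual to the
generated subalgebra still reflects the order, hence is all of `B`. -/
lemma eq_top_of_reflecting [D.IsLocallyFinite] (hC : C.ordered = false)
    (hepi : ∀ (A B : D.Alg) (f : A ⟶ B), Epi f → Function.Surjective f) (B : D.FinAlg)
    {ι : Type*} (A : ι → D.FinAlg) (q : ∀ i, B.obj ⟶ (A i).obj)
    (hq : ∀ x y, (∀ i, q i x ≤ q i y) → x ≤ y)
    (W : C.L.Substructure (Δ.functor.obj (Opposite.op B)).obj)
    (hW : ∀ i (p : (A i).obj ⟶ (outD Δ).obj), dualElem Δ B (q i ≫ p) ∈ W)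
    (p : B.obj ⟶ (outD Δ).obj) : dualElem Δ B p ∈ W := by
  obtain ⟨Q, k, hk, hkW⟩ := exists_dual_quotient Δ hC hepi B W
  refine (hkW p).1 (exists_factor hk p fun x y hxy => hom_monotone p (hq x y fun i => ?_))
  refine le_of_forall_out Δ hC (A i) _ _ fun r => ?_
  obtain ⟨r', hr'⟩ := (hkW (q i ≫ r)).2 (hW i r)
  change (q i ≫ r) x ≤ (q i ≫ r) y
  rw [hr']
  exact hom_monotone r' hxy

end Duality

end Eilenberg

/-! ### Quotients of algebras for the monad -/

namespace Eilenberg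

open Variety

variable {S : Type} {D : Variety.{u}}

lemma sort_hom_ext {X Y : S → D.Alg} {f g : X ⟶ Y} (h : ∀ s x, f s x = g s x) : f = g :=
  funext fun s => hom_ext (h s)

lemma Surj.cancel {X Y Z : S → D.Alg} {f : X ⟶ Y} (hf : Surj f) {g h : Y ⟶ Z}
    (e : f ≫ g = f ≫ h) : g = h := sort_hom_ext fun s y => by
  obtain ⟨x, rfl⟩ := hf s y
  exact congrArg (fun k : X ⟶ Z => k s x) e

lemma Surj.epi {X Y : S → D.Alg} {f : X ⟶ Y} (hf : Surj f) : Epi f :=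
  ⟨fun _ _ e => hf.cancel e⟩

lemma OrderReflecting.cancel {X Y Z : S → D.Alg} {f : Y ⟶ Z} (hf : OrderReflecting f)
    {g h : X ⟶ Y} (e : g ≫ f = h ≫ f) : g = h := sort_hom_ext fun s x => by
  have := congrArg (fun k : X ⟶ Z => k s x) e
  exact le_antisymm (hf s _ _ this.le) (hf s _ _ this.ge)

/-- Epimorphisms of `D^S` are sortwise epimorphisms. A pair of morphisms out of the sort `s` is
extended to all sorts by taking a power with exponent `r = s` of the codomain in the sort `r`. -/
lemma epi_sort {X Y : S → D.Alg} (f : X ⟶ Y) [Epi f] (s : S) : Epi (f s) := by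
  refine ⟨fun {Z} g h e => ?_⟩
  let E : S → D.Alg := fun r => prod fun _ : PLift (r = s) => Z
  let ext : (Y s ⟶ Z) → (Y ⟶ E) := fun k r =>
    { toFun := fun y i => k (i.down ▸ y)
      monotone' := fun x y hxy i => by
        obtain ⟨rfl⟩ := i
        exact hom_monotone k hxy
      map_op := fun l x => funext fun i => by
        obtain ⟨rfl⟩ := i
        exact hom_map_op k l x }
  have key : f ≫ ext g = f ≫ ext h := sort_hom_ext fun r x => funext fun i => by
    obtain ⟨rfl⟩ := i
    exact congrArg (fun k : X _ ⟶ Z => k x) e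
  have := (cancel_epi f).1 key
  exact hom_ext fun y => congrFun (congrArg (fun k : Y ⟶ E => k s y) this) ⟨rfl⟩

lemma exists_factor_sort {X Y Z : S → D.Alg} {f : X ⟶ Y} (hf : Surj f) (g : X ⟶ Z)
    (h : ∀ s x y, f s x ≤ f s y → g s x ≤ g s y) : ∃ q : Y ⟶ Z, g = f ≫ q := by
  choose q hq using fun s => exists_factor (hf s) (g s) (h s)
  exact ⟨q, funext hq⟩

variable {T : Monad (S → D.Alg)}

lemma Surj.map [T.toFunctor.PreservesEpimorphisms]
    (hepi : ∀ (A B : D.Alg) (f : A ⟶ B), Epi f → Function.Surjective f)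
    {X Y : S → D.Alg} {f : X ⟶ Y} (hf : Surj f) : Surj (T.map f) := fun s => by
  have := hf.epi
  have : Epi (T.map f) := T.toFunctor.map_epi f
  exact hepi _ _ _ (epi_sort (T.map f) s)

/-- If a homomorphism factorizes in `D^S` through a surjective homomorphism `e`, then the second
factor is a homomorphism, because `T e` is surjective and can be cancelled. -/
lemma exists_hom_of_comp [T.toFunctor.PreservesEpimorphisms]
    (hepi : ∀ (A B : D.Alg) (f : A ⟶ B), Epi f → Function.Surjective f)
    {A B E : T.Algebra} (e : A ⟶ B) (he : Surj e.f) (g : A ⟶ E)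
    (q : B.A ⟶ E.A) (h : g.f = e.f ≫ q) : ∃ k : B ⟶ E, k.f = q ∧ g = e ≫ k := by
  refine ⟨⟨q, (he.map (T := T) hepi).cancel ?_⟩, rfl, Monad.Algebra.Hom.ext h⟩
  rw [← Category.assoc, ← T.map_comp, ← h, g.h, e.h_assoc, h]

/-- Homomorphisms have images. The structure of the image is the diagonal fill-in of the square
formed by the surjection `T e` and an order-reflecting morphism. -/
lemma exists_image_alg [T.toFunctor.PreservesEpimorphisms]
    (hepi : ∀ (A B : D.Alg) (f : A ⟶ B), Epi f → Function.Surjective f)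
    {A B : T.Algebra} (h : A ⟶ B) :
    ∃ (I : T.Algebra) (e : A ⟶ I) (m : I ⟶ B), Surj e.f ∧ OrderReflecting m.f ∧ h = e ≫ m := by
  choose I e m he hm hI using fun s => exists_image (fun _ : PUnit => h.f s)
  let e' : A.A ⟶ I := e
  let m' : I ⟶ B.A := fun s => m s PUnit.unit
  have hem : h.f = e' ≫ m' := funext fun s => hm s PUnit.unit
  have he' : Surj e' := he
  have hm' : OrderReflecting m' := fun s x y hxy => hI s x y fun _ => hxy
  have hTe : Surj (T.map e') := he'.map hepi
  have hsq : A.a ≫ e' ≫ m' = T.map e' ≫ T.map m' ≫ B.a := by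
    rw [← hem, ← Functor.map_comp_assoc, ← hem, h.h]
  choose β hβ using fun s => exists_lift_of_reflecting (hm' s) ((T.map m' ≫ B.a) s) fun y => by
    obtain ⟨x, rfl⟩ := hTe s y
    exact ⟨(A.a ≫ e') s x, congrArg (fun k : T.obj A.A ⟶ B.A => k s x) hsq⟩
  let b : T.obj I ⟶ I := β
  have hb : b ≫ m' = T.map m' ≫ B.a := funext hβ
  have heb : T.map e' ≫ b = A.a ≫ e' := hm'.cancel <| by
    rw [Category.assoc, hb, Category.assoc, hsq]
  refine ⟨⟨I, b, hm'.cancel ?_, hm'.cancel ?_⟩, ⟨e', heb⟩, ⟨m', hb.symm⟩, he', hm',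
    Monad.Algebra.Hom.ext hem⟩
  · rw [Category.assoc, hb, ← Category.assoc, ← T.η.naturality m', Category.assoc, B.unit]
    exact (Category.comp_id m').trans (Category.id_comp m').symm
  · rw [Category.assoc, hb, ← T.μ.naturality_assoc m', B.assoc, Category.assoc, hb,
      ← Functor.map_comp_assoc, hb, Functor.map_comp_assoc]
    rfl

/-- The projections of a product of algebras jointly reflect the order, because the forgetful
functor preserves products. -/
lemma le_of_forall_proj {ι : Type} (A : ι → T.Algebra) [Limits.HasProduct A] (s : S)
    (x y : (∏ᶜ A).A s) (h : ∀ i, (Limits.Pi.π A i).f s x ≤ (Limits.Pi.π A i).f s y) : x ≤ y := by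
  let K : Limits.Cone (Discrete.functor A ⋙ T.forget) :=
    { pt := fun s => prod fun i => (A i).A s
      π := Discrete.natTrans fun i s =>
        { toFun := fun x => x i.as
          monotone' := fun _ _ h => h i.as
          map_op := fun _ _ => rfl } }
  have : Limits.PreservesLimitsOfSize.{0, 0} T.forget := T.adj.rightAdjoint_preservesLimits
  let hl := Limits.isLimitOfPreserves T.forget (Limits.productIsProduct A)
  let f : (∏ᶜ A).A ⟶ K.pt := fun s =>
    { toFun := fun x i => (Limits.Pi.π A i).f s x
      monotone' := fun _ _ h i => hom_monotone ((Limits.Pi.π A i).f s) h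
      map_op := fun k x => funext fun i => hom_map_op ((Limits.Pi.π A i).f s) k x }
  -- `f` is split by the morphism from the sortwise product that the limit property provides.
  have hf : f ≫ hl.lift K = 𝟙 (∏ᶜ A).A := hl.hom_ext fun j => by
    rw [Category.assoc, hl.fac K j]
    exact (Category.id_comp _).symm
  have hx : ∀ z, hl.lift K s (f s z) = z := fun z =>
    congrArg (fun k : (∏ᶜ A).A ⟶ (∏ᶜ A).A => k s z) hf
  rw [← hx x, ← hx y]
  exact hom_monotone (hl.lift K s) h

variable (F : ObjectProperty T.Algebra) [IsRecognizerClass F]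

/-- Finitely many quotients have a common refinement that is subdirectly embedded into their
product. -/
lemma exists_subdirect [T.toFunctor.PreservesEpimorphisms]
    (hepi : ∀ (A B : D.Alg) (f : A ⟶ B), Epi f → Function.Surjective f)
    {A : T.Algebra} {ι : Type} [Finite ι] (q : ι → Quo F A) :
    ∃ (e : Quo F A) (m : ∀ i, e.cod ⟶ (q i).cod), (∀ i, (q i).hom = e.hom ≫ m i) ∧
      ∀ s x y, (∀ i, (m i).f s x ≤ (m i).f s y) → x ≤ y := by
  have := hasProduct fun i => (q i).cod
  obtain ⟨I, e, m, he, hm, h⟩ := exists_image_alg hepi (Limits.Pi.lift fun i => (q i).hom)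
  have hF : F (∏ᶜ fun i => (q i).cod) := ObjectProperty.prop_pi F _ fun i => (q i).mem
  refine ⟨⟨I, IsRecognizerClass.of_subalgebra m hm hF, e, he⟩,
    fun i => m ≫ Limits.Pi.π _ i, fun i => ?_, fun s x y hxy => hm s x y ?_⟩
  · rw [← Category.assoc, ← h, Limits.Pi.lift_π]
  · exact le_of_forall_proj _ s _ _ hxy

end Eilenberg

namespace Eilenberg

open Variety

variable {S : Type} {D C : Variety.{u}} [C.IsLocallyFinite]
  {Δ : D.FinAlgᵒᵖ ≌ C.FinAlg} {T : Monad (S → D.Alg)} {F : ObjectProperty T.Algebra}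
  {Al : S → Type u}

/-! ### Languages recognized by a quotient -/

/-- The language recognized by a quotient of the free algebra with the given predicate on its
codomain. -/
noncomputable def recLang (e : Quo F (freeAlg T Al)) (p : e.cod.A ⟶ fun _ => (outD Δ).obj) :
    Rec Δ F Al :=
  ⟨e.hom.f ≫ p, e.cod, e.mem, e.hom, p, rfl⟩

lemma recLang_sort (e : Quo F (freeAlg T Al)) (p : e.cod.A ⟶ fun _ => (outD Δ).obj) (s : S) :
    (recLang e p).1 s = e.hom.f s ≫ p s := rfl

lemma recLang_of_le {e e' : Quo F (freeAlg T Al)} (h : e ≤ e')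
    (p : e.cod.A ⟶ fun _ => (outD Δ).obj) : ∃ p', recLang e p = recLang e' p' := by
  obtain ⟨q, hq⟩ := h
  refine ⟨q.f ≫ p, Subtype.ext ?_⟩
  change e.hom.f ≫ p = e'.hom.f ≫ q.f ≫ p
  rw [hq, Monad.Algebra.comp_f, Category.assoc]

open Classical in
/-- A morphism in one sort extends to all sorts by `⊥`. -/
lemma exists_extend (c : C.L.Constants) (X : S → D.Alg) (s : S) (r : X s ⟶ (outD Δ).obj) :
    ∃ p : X ⟶ fun _ => (outD Δ).obj, p s = r :=
  ⟨Function.update (β := fun s => X s ⟶ (outD Δ).obj) (fun _ => bot c _) s r,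
    Function.update_self ..⟩

open Classical in
lemma deriv_sort (c : C.L.Constants) (u : UnaryOp (freeAlg T Al).A) (L : Lang Δ T Al) :
    deriv c u L u.1 = u.2.2 ≫ L u.2.1 :=
  Function.update_self ..

open Classical in
lemma deriv_sort_of_ne (c : C.L.Constants) (u : UnaryOp (freeAlg T Al).A) (L : Lang Δ T Al)
    {s : S} (h : s ≠ u.1) : deriv c u L s = bot c _ :=
  Function.update_of_ne h ..

lemma Quo.isUQuotient {U : Set (UnaryOp (freeAlg T Al).A)}
    (hU : IsUnaryPresentation F (freeAlg T Al) U) (e : Quo F (freeAlg T Al)) :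
    IsUQuotient U e.hom.f :=
  (hU _ e.hom.f e.surj ⟨e, 𝟙 _, (Category.comp_id _).symm⟩).1
    ⟨e.cod.a, e.cod.unit, e.cod.assoc, e.hom.h⟩

lemma LocalPseudovariety.exists_upper_bound (I : LocalPseudovariety F Al) {κ : Type*} [Finite κ]
    (e : κ → Quo F (freeAlg T Al)) (he : ∀ i, toAntisymmetrization (· ≤ ·) (e i) ∈ I) :
    ∃ e', toAntisymmetrization (· ≤ ·) e' ∈ I ∧ ∀ i, e i ≤ e' := by
  have := I.nonempty.to_subtype
  obtain ⟨⟨z, hz⟩, h⟩ := (directedOn_iff_directed.1 I.directed).finite_le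
    (fun i => (⟨_, he i⟩ : (I : Set (Antisymmetrization (Quo F (freeAlg T Al)) (· ≤ ·)))))
  induction z using Quotient.inductionOn' with | _ e' =>
  exact ⟨e', hz, h⟩

variable [IsRecognizerClass F]

lemma exists_recLang [T.toFunctor.PreservesEpimorphisms]
    (hepi : ∀ (A B : D.Alg) (f : A ⟶ B), Epi f → Function.Surjective f) (L : Rec Δ F Al) :
    ∃ e p, L = recLang e p := by
  obtain ⟨L, A, hA, h, p, rfl⟩ := L
  obtain ⟨I, e, m, he, hm, rfl⟩ := exists_image_alg hepi h
  exact ⟨⟨I, IsRecognizerClass.of_subalgebra m hm hA, e, he⟩, m.f ≫ p,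
    Subtype.ext (Category.assoc _ _ _)⟩

/-- The codomain of a quotient in the sort `s`, as a finite algebra. -/
def Quo.sort {A : T.Algebra} (e : Quo F A) (s : S) : D.FinAlg :=
  ⟨e.cod.A s, IsRecognizerClass.finite _ e.mem s⟩

/-- The order on quotients is determined by the languages they recognize, because the object of
outputs cogenerates the finite algebras. -/
lemma le_of_recLang (hC : C.ordered = false) (c : C.L.Constants)
    [T.toFunctor.PreservesEpimorphisms]
    (hepi : ∀ (A B : D.Alg) (f : A ⟶ B), Epi f → Function.Surjective f)
    {e e' : Quo F (freeAlg T Al)}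
    (h : ∀ p : e.cod.A ⟶ fun _ => (outD Δ).obj, ∃ p', recLang e p = recLang e' p') : e ≤ e' := by
  obtain ⟨q, hq⟩ := exists_factor_sort e'.surj e.hom.f fun s x y hxy =>
    le_of_forall_out Δ hC (e.sort s) _ _ fun r => by
      obtain ⟨p, rfl⟩ := exists_extend c e.cod.A s r
      obtain ⟨p', hp'⟩ := h p
      have := congrArg (fun L : Rec Δ F Al => L.1 s) hp'
      change (e.hom.f s ≫ p s) x ≤ (e.hom.f s ≫ p s) y
      simp only [recLang_sort] at this
      rw [this]
      exact hom_monotone (p' s) hxy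
  obtain ⟨k, -, hk⟩ := exists_hom_of_comp hepi e'.hom e'.surj e.hom q hq
  exact ⟨k, hk⟩

variable [D.IsLocallyFinite]

/-- In every sort, the operations on languages that factorize through a morphism into a finite
algebra `A` are those of the dual of `A`. -/
lemma funMap_sort {n : ℕ} (f : C.L.Functions n) (L : Fin n → Rec Δ F Al) (s : S) (A : D.FinAlg)
    (e : (freeAlg T Al).A s ⟶ A.obj) (q : Fin n → (A.obj ⟶ (outD Δ).obj))
    (h : ∀ i, (L i).1 s = e ≫ q i) :
    (FirstOrder.Language.Structure.funMap f L : Rec Δ F Al).1 s =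
      e ≫ (dualElem Δ A).symm
        (FirstOrder.Language.Structure.funMap f fun i => dualElem Δ A (q i)) := by
  refine hom_ext fun x => (outEquiv Δ).injective ?_
  refine (Rec.eval_funMap f L s x).trans (Eq.trans ?_ (outEquiv_op Δ A f q (e x)).symm)
  refine congrArg _ (funext fun i => ?_)
  rw [Rec.eval, h]
  rfl

/-! ### From local varieties to local pseudovarieties -/

namespace LocalVariety

variable {c : C.L.Constants} {U : Set (UnaryOp (freeAlg T Al).A)}

/-- Closure under diagonals: a local variety is determined by the components of its languages. -/
lemma mem_of_sort (W : LocalVariety Δ F Al c U) (L : Rec Δ F Al)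
    (h : ∀ s, ∃ M : Rec Δ F Al, M ∈ W.toSub ∧ M.1 s = L.1 s) : L ∈ W.toSub := by
  choose K hK hKL using h
  obtain ⟨M, hM, h⟩ := W.diag_mem K hK
  rwa [show L = M from Subtype.ext (by rw [h]; exact funext fun s => (hKL s).symm)]

/-- All languages recognized by the quotient `e` lie in `W`. -/
def Contains (W : LocalVariety Δ F Al c U) (e : Quo F (freeAlg T Al)) : Prop :=
  ∀ p : e.cod.A ⟶ fun _ => (outD Δ).obj, recLang e p ∈ W.toSub

lemma Contains.mono {W : LocalVariety Δ F Al c U} {e e' : Quo F (freeAlg T Al)}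
    (h : W.Contains e') (he : e ≤ e') : W.Contains e := fun p => by
  obtain ⟨p', hp'⟩ := recLang_of_le he p
  rw [hp']
  exact h p'

/-- The morphisms `p` out of a finite algebra `A` such that `e ≫ p` is the component in the sort `s`
of a language in `W`, as a subalgebra of the dual of `A`. -/
def component (W : LocalVariety Δ F Al c U) (s : S) (A : D.FinAlg)
    (e : (freeAlg T Al).A s ⟶ A.obj) :
    C.L.Substructure (Δ.functor.obj (Opposite.op A)).obj where
  carrier := {x | ∃ M : Rec Δ F Al, M ∈ W.toSub ∧ M.1 s = e ≫ (dualElem Δ A).symm x}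
  fun_mem f x hx := by
    choose M hM h using hx
    refine ⟨FirstOrder.Language.Structure.funMap f M, W.toSub.fun_mem f M hM, ?_⟩
    rw [funMap_sort f M s A e _ h]
    simp only [Equiv.apply_symm_apply]

lemma mem_component {W : LocalVariety Δ F Al c U} {s : S} {A : D.FinAlg}
    {e : (freeAlg T Al).A s ⟶ A.obj} (p : A.obj ⟶ (outD Δ).obj) :
    dualElem Δ A p ∈ W.component s A e ↔
      ∃ M : Rec Δ F Al, M ∈ W.toSub ∧ M.1 s = e ≫ p := by
  change (∃ M : Rec Δ F Al, M ∈ W.toSub ∧ M.1 s = e ≫ (dualElem Δ A).symm (dualElem Δ A p)) ↔ _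
  rw [Equiv.symm_apply_apply]

/-- The languages recognized by a subdirect product are generated by those recognized by the
factors. -/
lemma contains_of_reflecting (hC : C.ordered = false)
    (hepi : ∀ (A B : D.Alg) (f : A ⟶ B), Epi f → Function.Surjective f)
    (W : LocalVariety Δ F Al c U) {ι : Type*} {q : ι → Quo F (freeAlg T Al)}
    (hq : ∀ i, W.Contains (q i)) {e : Quo F (freeAlg T Al)} (m : ∀ i, e.cod ⟶ (q i).cod)
    (hm : ∀ i, (q i).hom = e.hom ≫ m i)
    (h : ∀ s x y, (∀ i, (m i).f s x ≤ (m i).f s y) → x ≤ y) : W.Contains e := fun p => by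
  refine W.mem_of_sort _ fun s => (mem_component (A := e.sort s) (p s)).1 ?_
  refine eq_top_of_reflecting Δ hC hepi (e.sort s) (fun i => (q i).sort s) (fun i => (m i).f s)
    (h s) _ (fun i r => ?_) (p s)
  obtain ⟨p', rfl⟩ := exists_extend c (q i).cod.A s r
  refine (mem_component _).2 ⟨recLang (q i) p', hq i p', ?_⟩
  rw [recLang_sort, hm i]
  rfl

/-- Every language in a local variety `W` is recognized by a quotient that recognizes only
languages in `W`. A quotient `h` recognizing `L` is cut down, sort by sort, to the quotient dual to
the subalgebra of those predicates on the codomain of `h` that define languages in `W`. Closure of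
`W` under derivatives makes this a `U`-quotient, so the unary presentation provides the structure
of an algebra. -/
lemma exists_contains_of_mem (hC : C.ordered = false)
    [T.toFunctor.PreservesEpimorphisms]
    (hepi : ∀ (A B : D.Alg) (f : A ⟶ B), Epi f → Function.Surjective f)
    (hU : IsUnaryPresentation F (freeAlg T Al) U)
    (W : LocalVariety Δ F Al c U) {L : Rec Δ F Al} (hL : L ∈ W.toSub) :
    ∃ e p, W.Contains e ∧ L = recLang e p := by
  obtain ⟨h, p₀, rfl⟩ := exists_recLang hepi L
  have hquot : ∀ s, ∃ (Q : D.FinAlg) (k : h.cod.A s ⟶ Q.obj), Function.Surjective k ∧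
      ∀ p : h.cod.A s ⟶ (outD Δ).obj, (∃ p', p = k ≫ p') ↔
        ∃ M : Rec Δ F Al, M ∈ W.toSub ∧ M.1 s = h.hom.f s ≫ p := fun s => by
    obtain ⟨Q, k, hk, hV⟩ :=
      exists_dual_quotient Δ hC hepi (h.sort s) (W.component s (h.sort s) (h.hom.f s))
    exact ⟨Q, k, hk, fun p => (hV p).trans (mem_component _)⟩
  choose Q k hk hV using hquot
  let B : S → D.Alg := fun s => (Q s).obj
  let κ : h.cod.A ⟶ B := k
  have hsurj : Surj (h.hom.f ≫ κ) := fun s => (hk s).comp (h.surj s)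
  have hUq : IsUQuotient U (h.hom.f ≫ κ) := by
    intro u hu
    obtain ⟨v, hv⟩ := h.isUQuotient hU u hu
    obtain ⟨w, hw⟩ := exists_factor (hk u.1) (v ≫ k u.2.1) fun x y hxy =>
      le_of_forall_out Δ hC (Q u.2.1) _ _ fun r => by
        obtain ⟨M, hM, hMr⟩ := (hV u.2.1 _).1 ⟨r, rfl⟩
        obtain ⟨N, hN, hNM⟩ := W.deriv_mem M hM u hu
        have hr : N.1 u.1 = h.hom.f u.1 ≫ v ≫ k u.2.1 ≫ r := by
          rw [hNM, deriv_sort, hMr, ← Category.assoc, hv, Category.assoc]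
        obtain ⟨r', hr'⟩ := (hV u.1 (v ≫ k u.2.1 ≫ r)).2 ⟨N, hN, hr⟩
        change (v ≫ k u.2.1 ≫ r) x ≤ (v ≫ k u.2.1 ≫ r) y
        rw [hr']
        exact hom_monotone r' hxy
    refine ⟨w, ?_⟩
    change u.2.2 ≫ h.hom.f u.2.1 ≫ k u.2.1 = (h.hom.f u.1 ≫ k u.1) ≫ w
    rw [← Category.assoc, hv, Category.assoc, hw, Category.assoc]
  obtain ⟨β, h1, h2, h3⟩ := (hU B _ hsurj ⟨h, κ, rfl⟩).2 hUq
  let E : T.Algebra := ⟨B, β, h1, h2⟩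
  let e : freeAlg T Al ⟶ E := ⟨h.hom.f ≫ κ, h3⟩
  obtain ⟨κ', hκ', -⟩ := exists_hom_of_comp hepi h.hom h.surj e κ rfl
  have hF : F E := IsRecognizerClass.of_quotient κ' (hκ' ▸ hk) h.mem
  choose p hp using fun s => (hV s (p₀ s)).2 ⟨_, hL, recLang_sort _ _ _⟩
  refine ⟨⟨E, hF, e, hsurj⟩, p, fun r => W.mem_of_sort _ fun s => (hV s _).1 ⟨r s, rfl⟩, ?_⟩
  refine Subtype.ext (funext fun s => ?_)
  rw [recLang_sort, hp s]
  rfl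

/-- The local pseudovariety of those quotients that only recognize languages in `W`. -/
def toIdeal (hC : C.ordered = false) [T.toFunctor.PreservesEpimorphisms]
    (hepi : ∀ (A B : D.Alg) (f : A ⟶ B), Epi f → Function.Surjective f)
    (W : LocalVariety Δ F Al c U) : LocalPseudovariety F Al where
  carrier := {x | ∃ e, toAntisymmetrization (· ≤ ·) e = x ∧ W.Contains e}
  lower' := by
    rintro _ y hy ⟨e, rfl, he⟩
    induction y using Quotient.inductionOn' with | _ e' =>
    exact ⟨e', rfl, he.mono hy⟩
  nonempty' := by
    obtain ⟨e, m, hm, h⟩ := exists_subdirect F hepi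
      (fun i : Empty => (i.elim : Quo F (freeAlg T Al)))
    exact ⟨_, e, rfl, W.contains_of_reflecting hC hepi (fun i : Empty => i.elim) m hm h⟩
  directed' := by
    rintro _ ⟨e, rfl, he⟩ _ ⟨e', rfl, he'⟩
    obtain ⟨e'', m, hm, h⟩ := exists_subdirect F hepi (fun i : Bool => cond i e e')
    refine ⟨_, ⟨e'', rfl, W.contains_of_reflecting hC hepi ?_ m hm h⟩,
      ⟨m true, hm true⟩, ⟨m false, hm false⟩⟩
    rintro (_ | _)
    exacts [he', he]

lemma mem_toIdeal (hC : C.ordered = false) [T.toFunctor.PreservesEpimorphisms]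
    (hepi : ∀ (A B : D.Alg) (f : A ⟶ B), Epi f → Function.Surjective f)
    (W : LocalVariety Δ F Al c U) (e : Quo F (freeAlg T Al)) :
    toAntisymmetrization (· ≤ ·) e ∈ W.toIdeal hC hepi ↔ W.Contains e := by
  refine ⟨?_, fun he => ⟨e, rfl, he⟩⟩
  rintro ⟨e', he', h⟩
  exact h.mono (toAntisymmetrization_le_toAntisymmetrization_iff.1 he'.ge)

end LocalVariety

/-! ### From local pseudovarieties to local varieties -/

namespace LocalPseudovariety

variable [Finite S]

/-- The local variety of the languages recognized by some quotient in the ideal `I`. -/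
def toVariety (c : C.L.Constants) {U : Set (UnaryOp (freeAlg T Al).A)}
    (hU : IsUnaryPresentation F (freeAlg T Al) U) (I : LocalPseudovariety F Al) :
    LocalVariety Δ F Al c U where
  toSub :=
    { carrier := {L | ∃ e p, toAntisymmetrization (· ≤ ·) e ∈ I ∧ L = recLang e p}
      fun_mem := fun f L hL => by
        choose e p he hL using hL
        obtain ⟨e', he', hle⟩ := exists_upper_bound I e he
        choose q hq using fun i => recLang_of_le (hle i) (p i)
        refine ⟨e', _, he', Subtype.ext (funext fun s => funMap_sort f L s (e'.sort s)
          (e'.hom.f s) (fun i => q i s) fun i => ?_)⟩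
        rw [hL, hq]
        rfl }
  deriv_mem := by
    rintro _ ⟨e, p, he, rfl⟩ u hu
    obtain ⟨v, hv⟩ := e.isUQuotient hU u hu
    classical
    let p' : e.cod.A ⟶ fun _ => (outD Δ).obj :=
      Function.update (β := fun s => e.cod.A s ⟶ (outD Δ).obj) (fun _ => bot c _)
        u.1 (v ≫ p u.2.1)
    refine ⟨recLang e p', ⟨e, p', he, rfl⟩, funext fun s => ?_⟩
    rw [recLang_sort]
    by_cases hs : s = u.1
    · subst hs
      rw [deriv_sort, recLang_sort, ← Category.assoc, hv, Category.assoc]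
      exact congrArg _ (Function.update_self ..)
    · rw [deriv_sort_of_ne _ _ _ hs]
      exact congrArg _ (Function.update_of_ne hs ..)
  diag_mem := by
    intro K hK
    choose e p he hK using hK
    obtain ⟨e', he', hle⟩ := exists_upper_bound I e he
    choose q hq using fun s => recLang_of_le (hle s) (p s)
    refine ⟨recLang e' fun s => q s s, ⟨e', _, he', rfl⟩, funext fun s => ?_⟩
    change _ = (K s).1 s
    rw [hK, hq]
    rfl

lemma mem_of_contains (hC : C.ordered = false) (c : C.L.Constants)
    [T.toFunctor.PreservesEpimorphisms]
    (hepi : ∀ (A B : D.Alg) (f : A ⟶ B), Epi f → Function.Surjective f)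
    {U : Set (UnaryOp (freeAlg T Al).A)}
    (hU : IsUnaryPresentation F (freeAlg T Al) U) (I : LocalPseudovariety F Al)
    {e : Quo F (freeAlg T Al)} (h : (toVariety (Δ := Δ) c hU I).Contains e) :
    toAntisymmetrization (· ≤ ·) e ∈ I := by
  have : ∀ s, Finite (e.cod.A s) := fun s => (e.sort s).property
  have := (outD Δ).property
  have : Finite (e.cod.A ⟶ fun _ => (outD Δ).obj) :=
    inferInstanceAs (Finite (∀ s, e.cod.A s ⟶ (outD Δ).obj))
  choose e' q he' hq using h
  obtain ⟨e₁, he₁, hle⟩ := exists_upper_bound I e' he'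
  refine I.lower (a := toAntisymmetrization (· ≤ ·) e₁)
    (le_of_recLang hC c hepi (Δ := Δ) (e := e) (e' := e₁) fun p => ?_) he₁
  rw [hq p]
  exact recLang_of_le (hle p) _

end LocalPseudovariety

/-- The isomorphism between local varieties and local pseudovarieties. -/
noncomputable def localVarietyIso [Finite S] (hC : C.ordered = false) (c : C.L.Constants)
    [T.toFunctor.PreservesEpimorphisms]
    (hepi : ∀ (A B : D.Alg) (f : A ⟶ B), Epi f → Function.Surjective f)
    {U : Set (UnaryOp (freeAlg T Al).A)}
    (hU : IsUnaryPresentation F (freeAlg T Al) U) :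
    LocalVariety Δ F Al c U ≃o LocalPseudovariety F Al :=
  Equiv.toOrderIso
    { toFun := fun W => W.toIdeal hC hepi
      invFun := fun I => LocalPseudovariety.toVariety c hU I
      left_inv := fun W => by
        refine LocalVariety.ext (SetLike.ext fun L => ⟨?_, fun hL => ?_⟩)
        · rintro ⟨e, p, he, rfl⟩
          exact (W.mem_toIdeal hC hepi e).1 he p
        · obtain ⟨e, p, he, h⟩ := W.exists_contains_of_mem hC hepi hU hL
          exact ⟨e, p, (W.mem_toIdeal hC hepi e).2 he, h⟩
      right_inv := fun I => by
        refine SetLike.ext fun x => ?_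
        induction x using Quotient.inductionOn' with | _ e =>
        refine (LocalVariety.mem_toIdeal hC hepi _ e).trans
          ⟨LocalPseudovariety.mem_of_contains hC c hepi hU I, fun he p => ⟨e, p, he, rfl⟩⟩ }
    (by
      rintro W W' h _ ⟨e, rfl, he⟩
      exact ⟨e, rfl, fun p => h (he p)⟩)
    (by
      rintro I I' h _ ⟨e, p, he, rfl⟩
      exact ⟨e, p, h he, rfl⟩)

/-! ### The lattices -/

/-- The intersection of a nonempty set of local varieties. -/
noncomputable def LocalVariety.inter {c : C.L.Constants} {U : Set (UnaryOp (freeAlg T Al).A)}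
    (𝒲 : Set (LocalVariety Δ F Al c U)) (h : 𝒲.Nonempty) : LocalVariety Δ F Al c U where
  toSub := sInf (LocalVariety.toSub '' 𝒲)
  deriv_mem L hL u hu := by
    replace hL := Set.forall_mem_image.1 (FirstOrder.Language.Substructure.mem_sInf.1 hL)
    obtain ⟨W, hW⟩ := h
    obtain ⟨M, -, hM⟩ := W.deriv_mem L (hL hW) u hu
    refine ⟨M, FirstOrder.Language.Substructure.mem_sInf.2
      (Set.forall_mem_image.2 fun W' hW' => ?_), hM⟩
    obtain ⟨M', hM', h'⟩ := W'.deriv_mem L (hL hW') u hu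
    rwa [show M = M' from Subtype.ext (hM.trans h'.symm)]
  diag_mem K hK := by
    replace hK := fun s =>
      Set.forall_mem_image.1 (FirstOrder.Language.Substructure.mem_sInf.1 (hK s))
    obtain ⟨W, hW⟩ := h
    obtain ⟨M, -, hM⟩ := W.diag_mem K fun s => hK s hW
    refine ⟨M, FirstOrder.Language.Substructure.mem_sInf.2
      (Set.forall_mem_image.2 fun W' hW' => ?_), hM⟩
    obtain ⟨M', hM', h'⟩ := W'.diag_mem K fun s => hK s hW'
    rwa [show M = M' from Subtype.ext (hM.trans h'.symm)]

lemma LocalVariety.isGLB_inter {c : C.L.Constants} {U : Set (UnaryOp (freeAlg T Al).A)}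
    (𝒲 : Set (LocalVariety Δ F Al c U)) (h : 𝒲.Nonempty) : IsGLB 𝒲 (inter 𝒲 h) :=
  ⟨fun W hW => sInf_le (a := W.toSub) (Set.mem_image_of_mem _ hW),
    fun W hW => le_sInf (a := W.toSub) (Set.forall_mem_image.2 fun _ hW' => hW hW')⟩

lemma IsLatticeOrder.of_orderIso {P Q : Type*} [PartialOrder P] [PartialOrder Q] (φ : P ≃o Q)
    (h : IsLatticeOrder P) : IsLatticeOrder Q := fun a b => by
  obtain ⟨⟨x, hx⟩, y, hy⟩ := h (φ.symm a) (φ.symm b)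
  have himg : φ '' {φ.symm a, φ.symm b} = {a, b} := by simp [Set.image_pair]
  exact ⟨⟨φ x, himg ▸ φ.isLUB_image'.2 hx⟩, φ y, himg ▸ φ.isGLB_image'.2 hy⟩

/-- There is a largest local variety, recognized by the ideal of all quotients. Hence suprema are
intersections of nonempty sets of upper bounds. -/
lemma LocalVariety.isLatticeOrder [Finite S] (c : C.L.Constants)
    [T.toFunctor.PreservesEpimorphisms]
    (hepi : ∀ (A B : D.Alg) (f : A ⟶ B), Epi f → Function.Surjective f)
    {U : Set (UnaryOp (freeAlg T Al).A)}
    (hU : IsUnaryPresentation F (freeAlg T Al) U) :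
    IsLatticeOrder (LocalVariety Δ F Al c U) := fun W W' => by
  let I : LocalPseudovariety F Al :=
    { carrier := Set.univ
      lower' := isLowerSet_univ
      nonempty' := by
        obtain ⟨e, -⟩ := exists_subdirect F hepi
          (fun i : Empty => (i.elim : Quo F (freeAlg T Al)))
        exact ⟨toAntisymmetrization (· ≤ ·) e, trivial⟩
      directed' := by
        intro x _ y _
        induction x using Quotient.inductionOn' with | _ e =>
        induction y using Quotient.inductionOn' with | _ e' =>
        obtain ⟨e'', m, hm, -⟩ := exists_subdirect F hepi (fun i : Bool => cond i e e')
        exact ⟨toAntisymmetrization (· ≤ ·) e'', trivial, ⟨m true, hm true⟩,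
          ⟨m false, hm false⟩⟩ }
  have htop : ∀ X : LocalVariety Δ F Al c U, X ≤ LocalPseudovariety.toVariety c hU I :=
    fun X L _ => by
      obtain ⟨e, p, h⟩ := exists_recLang hepi L
      exact ⟨e, p, trivial, h⟩
  have hne : (upperBounds {W, W'}).Nonempty :=
    ⟨LocalPseudovariety.toVariety c hU I, fun X _ => htop X⟩
  exact ⟨⟨_, isGLB_upperBounds.1 (LocalVariety.isGLB_inter _ hne)⟩,
    _, LocalVariety.isGLB_inter _ ⟨W, Set.mem_insert _ _⟩⟩

end Eilenberg

theorem mainTheorem2 {S : Type} [Finite S] (D C : Eilenberg.Variety.{u})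
    [D.IsLocallyFinite] [C.IsLocallyFinite]
    (hC : C.ordered = false) (c : C.L.Constants)
    (hepi : ∀ (A B : D.Alg) (f : A ⟶ B), Epi f → Function.Surjective f)
    (Δ : D.FinAlgᵒᵖ ≌ C.FinAlg)
    (T : Monad (S → D.Alg)) [T.toFunctor.PreservesEpimorphisms]
    (F : ObjectProperty T.Algebra) [Eilenberg.IsRecognizerClass F]
    (Al : S → Type u) [∀ s, Finite (Al s)]
    (U : Set (Eilenberg.UnaryOp (Eilenberg.freeAlg T Al).A))
    (hU : Eilenberg.IsUnaryPresentation F (Eilenberg.freeAlg T Al) U) :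
    Eilenberg.IsLatticeOrder (Eilenberg.LocalVariety Δ F Al c U) ∧
    Eilenberg.IsLatticeOrder (Eilenberg.LocalPseudovariety F Al) ∧
    Nonempty (Eilenberg.LocalVariety Δ F Al c U ≃o Eilenberg.LocalPseudovariety F Al) :=
  have hV := Eilenberg.LocalVariety.isLatticeOrder c hepi hU
  let φ := Eilenberg.localVarietyIso hC c hepi hU
  ⟨hV, hV.of_orderIso φ, ⟨φ⟩⟩
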